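/- **Theorem (Sparse row-based matrix reconstruction).** Let $A\in\mathbb{R}^{m\times d}$ have the (thin) singular value decomposition $A=USV^{T}$, where $U\in\mathbb{R}^{m\times d}$ has orthonormal columns, $V\in\mathbb{R}^{d\times d}$ is orthogonal, and $S=\mathrm{diag}(\sigma_1,\dots,\sigma_d)$ with $\sigma_1\ge\dots\ge\sigma_d\ge 0$ (this includes every $A$ of rank $d$). Let $u_t^{T}$ be the $t$-th row of $U$, and for $1\le k\le d$ let $A_k=U_kS_kV_k^{T}$, where $U_k,V_k$ consist of the first $k$ columns of $U,V$ and $S_k=\mathrm{diag}(\sigma_1,\dots,\sigma_k)$. Let $\|\cdot\|$ be the spectral norm for matrices and the Euclidean norm for vectors. Let $\varepsilon\in(0,1)$, $\beta\in(0,1]$, $\delta>0$, and let $p_1,\dots,p_m\ge 0$ with $\sum_{t}p_t=1$ satisfy $$p_t\ \ge\ \frac{\beta}{d}\,\|u_t\|^2\qquad(t=1,\dots,m).$$ Let $r$ be a non-negative integer with $$r\ \ge\ \frac{4(d-\beta)}{\beta\varepsilon^2}\,\ln\frac{2d}{\delta}.$$ Draw indices $t_1,\dots,t_r$ independently with $\Pr[t_j=t]=p_t$,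 let $Q\in\mathbb{R}^{r\times m}$ be the matrix whose $j$-th row is $e_{t_j}^{T}/\sqrt{r\,p_{t_j}}$, and let $\tilde A=QA$. Then, with probability at least $1-\delta$, for every $k=1,\dots,d$, $$\|A-A\tilde\Pi_k\|\ \le\ \left(\frac{1+\varepsilon}{1-\varepsilon}\right)^{1/2}\|A-A_k\|,$$ where $\tilde\Pi_k=\tilde V_k\tilde V_k^{T}$ is the orthogonal projection onto the span of the top $k$ right singular vectors of $\tilde A$, that is, $\tilde V_k$ consists of the first $k$ columns of $\tilde V$ in a full singular value decomposition $\tilde A=\tilde U\tilde\Sigma\tilde V^{T}$ with non-increasing singular values; on this event the bound holds for all $k$ and for every choice of such a decomposition. -/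

import Mathlib

open MeasureTheory ProbabilityTheory
open scoped Matrix Matrix.Norms.L2Operator

/- With `Matrix.Norms.L2Operator` open, `‖M‖` for a matrix `M` is the spectral norm, i.e. the
operator norm with respect to the Euclidean norms. -/

noncomputable section

/-- `A = U S Vᵀ` is a thin singular value decomposition of an `m × d` matrix: the columns of the
`m × d` matrix `U` are orthonormal, `S = diag (σ 0, …, σ (d - 1))` with
`σ 0 ≥ σ 1 ≥ … ≥ 0`, and the `d × d` matrix `V` is orthogonal. -/
structure IsThinSVD {m d : ℕ} (A U : Matrix (Fin m) (Fin d) ℝ) (σ : Fin d → ℝ)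
    (V : Matrix (Fin d) (Fin d) ℝ) : Prop where
  orthonormal_left : Uᵀ * U = 1
  orthogonal_right : V ∈ Matrix.orthogonalGroup (Fin d) ℝ
  nonneg : ∀ i, 0 ≤ σ i
  antitone : Antitone σ
  eq : A = U * Matrix.diagonal σ * Vᵀ

/-- The rectangular `r × d` diagonal matrix with entries `σ 0, σ 1, …`. -/
def rectDiagonal (r : ℕ) {d : ℕ} (σ : Fin d → ℝ) : Matrix (Fin r) (Fin d) ℝ :=
  Matrix.of fun i j => if (i : ℕ) = (j : ℕ) then σ j else 0

/-- `M = U Σ Vᵀ` is a full singular value decomposition of an arbitrary `r × d` matrix: `U` and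
`V` are orthogonal of sizes `r` and `d`, and `Σ` is the `r × d` rectangular diagonal matrix of
the singular values `σ 0 ≥ σ 1 ≥ … ≥ 0` (padded by zeros to length `d` when `r < d`).
The columns of `V` are the right singular vectors in order of decreasing singular value. -/
structure IsFullSVD {r d : ℕ} (M : Matrix (Fin r) (Fin d) ℝ) (U : Matrix (Fin r) (Fin r) ℝ)
    (σ : Fin d → ℝ) (V : Matrix (Fin d) (Fin d) ℝ) : Prop where
  orthogonal_left : U ∈ Matrix.orthogonalGroup (Fin r) ℝ
  orthogonal_right : V ∈ Matrix.orthogonalGroup (Fin d) ℝ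
  nonneg : ∀ i, 0 ≤ σ i
  antitone : Antitone σ
  padding : ∀ i : Fin d, r ≤ (i : ℕ) → σ i = 0
  eq : M = U * rectDiagonal r σ * Vᵀ

/-- The submatrix formed by the first `k` columns. -/
def firstCols {n d : ℕ} (M : Matrix (Fin n) (Fin d) ℝ) {k : ℕ} (hk : k ≤ d) :
    Matrix (Fin n) (Fin k) ℝ :=
  M.submatrix id (Fin.castLE hk)

/-- The rank-`k` truncation `A_k = U_k S_k V_kᵀ` of a singular value decomposition. -/
def truncatedSVD {m d : ℕ} (U : Matrix (Fin m) (Fin d) ℝ) (σ : Fin d → ℝ)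
    (V : Matrix (Fin d) (Fin d) ℝ) {k : ℕ} (hk : k ≤ d) : Matrix (Fin m) (Fin d) ℝ :=
  firstCols U hk * Matrix.diagonal (fun i => σ (Fin.castLE hk i)) * (firstCols V hk)ᵀ

/-- The orthogonal projection `V_k V_kᵀ` onto the span of the first `k` columns of an orthogonal
matrix `V`. -/
def topProjection {d : ℕ} (V : Matrix (Fin d) (Fin d) ℝ) {k : ℕ} (hk : k ≤ d) :
    Matrix (Fin d) (Fin d) ℝ :=
  firstCols V hk * (firstCols V hk)ᵀ

/-- The row-sampling matrix `Q` of size `r × m` with sampling probabilities `p` and sampled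
indices `t 0, …, t (r - 1)`: its `j`-th row is `e_{t j} / √(r p_{t j})`. -/
def rowSamplingMatrix {m r : ℕ} (p : Fin m → ℝ) (t : Fin r → Fin m) :
    Matrix (Fin r) (Fin m) ℝ :=
  Matrix.of fun j i => if i = t j then 1 / √((r : ℝ) * p i) else 0

end

/-! Everything rests on one event: `‖QUx‖²` differs from `‖x‖²` by at most `ε‖x‖²` for all `x`.
Replacing `x` by `SVᵀx` gives `(1-ε)‖Ax‖² ≤ ‖Ãx‖² ≤ (1+ε)‖Ax‖²`. The rest is then deterministic,
hence valid for all `k` and all decompositions of `Ã` at once (`norm_sub_mul_topProjection_le`). For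
`y = x - Π̃ₖx` the lower bound gives `(1-ε)‖Ay‖² ≤ ‖Ãy‖² ≤ σ̃ₖ₊₁²‖x‖²`, and the upper bound with a
min-max argument gives `σ̃ₖ₊₁² ≤ (1+ε)‖A-Aₖ‖²`.

For the probability, `UᵀQᵀQU - 1` is the mean of `r` independent copies of the centred matrix `uuᵀ/p
- 1`. With `L = d/β - 1`, the sampling condition bounds both the quadratic form of this matrix and
its second moment by `L`. A matrix Bernstein bound (`sum_weight_lt_le`), applied to both signs,
gives failure probability at most `2d exp(-rε²/(4L)) ≤ δ`. It follows from Markov's inequality for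
the trace exponential, where Golden–Thompson (`trace_exp_add_le`) separates the independent factors.
Golden–Thompson itself combines `tr (XY)^N ≤ tr X^N Y^N` for `N = 2^k` with the Lie–Trotter formula.
-/

namespace Matrix

/-! ### Hölder-type trace inequalities for powers of two -/

section TraceInequalities

variable {n : Type*} [Fintype n]

/-- Cauchy–Schwarz for the Frobenius inner product; the base case of Hölder's inequality below. -/
theorem sq_trace_mul_le (X Y : Matrix n n ℝ) :
    (X * Y).trace ^ 2 ≤ (Xᵀ * X).trace * (Yᵀ * Y).trace := by
  have h1 : (X * Y).trace = ∑ q : n × n, X q.1 q.2 * Y q.2 q.1 := by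
    simp [trace, mul_apply, Fintype.sum_prod_type]
  have h2 : (Xᵀ * X).trace = ∑ q : n × n, X q.1 q.2 ^ 2 := by
    rw [trace_mul_comm]
    simp [trace, mul_apply, Fintype.sum_prod_type, sq]
  have h3 : (Yᵀ * Y).trace = ∑ q : n × n, Y q.2 q.1 ^ 2 := by
    simp [trace, mul_apply, Fintype.sum_prod_type, sq]
  rw [h1, h2, h3]
  exact Finset.sum_mul_sq_le_sq_mul_sq _ _ _

variable [DecidableEq n]

theorem trace_pow_mul_comm (X Y : Matrix n n ℝ) (N : ℕ) :
    ((X * Y) ^ N).trace = ((Y * X) ^ N).trace := by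
  cases N with
  | zero => simp
  | succ N =>
    have h : (X * Y) ^ (N + 1) = X * ((Y * X) ^ N * Y) := by
      induction N with
      | zero => simp
      | succ N ih => rw [pow_succ, ih, pow_succ (Y * X)]; noncomm_ring
    rw [h, trace_mul_comm, pow_succ]
    congr 1
    noncomm_ring

theorem trace_gram_pow_nonneg (X : Matrix n n ℝ) (N : ℕ) : 0 ≤ ((Xᵀ * X) ^ N).trace := by
  have h : (Xᵀ * X).PosSemidef := by simpa using posSemidef_conjTranspose_mul_self X
  exact (h.pow N).trace_nonneg

theorem list_prod_range_two_mul {M : Type*} [Monoid M] (A : ℕ → M) (N : ℕ) :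
    ((List.range (2 * N)).map A).prod =
      ((List.range N).map fun i => A (2 * i) * A (2 * i + 1)).prod := by
  induction N with
  | zero => simp
  | succ N ih =>
    rw [show 2 * (N + 1) = 2 * N + 1 + 1 by ring, List.range_succ, List.range_succ,
      List.range_succ]
    simp [ih]

theorem finset_prod_range_two_mul {M : Type*} [CommMonoid M] (f : ℕ → M) (N : ℕ) :
    ∏ i ∈ Finset.range (2 * N), f i = ∏ i ∈ Finset.range N, (f (2 * i) * f (2 * i + 1)) := by
  induction N with
  | zero => simp
  | succ N ih =>
    rw [show 2 * (N + 1) = 2 * N + 1 + 1 by ring, Finset.prod_range_succ, Finset.prod_range_succ,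
      Finset.prod_range_succ, ih, mul_assoc]

/-- Hölder's inequality for the trace of a product of `2 ^ (k + 1)` matrices. -/
theorem abs_trace_list_prod_pow_le (k : ℕ) (A : ℕ → Matrix n n ℝ) :
    |((List.range (2 ^ (k + 1))).map A).prod.trace| ^ (2 ^ (k + 1)) ≤
      ∏ i ∈ Finset.range (2 ^ (k + 1)), (((A i)ᵀ * A i) ^ (2 ^ k)).trace := by
  induction k generalizing A with
  | zero =>
    simpa [List.range_succ, Finset.prod_range_succ] using sq_trace_mul_le (A 0) (A 1)
  | succ k ih =>
    -- The induction hypothesis for the alternating sequence `P, Q, P, Q, …`, after extracting a `2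
    -- ^ k`-th root.
    have alt : ∀ P Q : Matrix n n ℝ, Pᵀ = P → Qᵀ = Q →
        ((P * Q) ^ (2 ^ k)).trace ^ 2 ≤
          (P ^ (2 ^ (k + 1))).trace * (Q ^ (2 ^ (k + 1))).trace := by
      intro P Q hP hQ
      have h := ih fun i => if i % 2 = 0 then P else Q
      have h1 : ∀ i, (2 * i + 1) % 2 = 1 := by omega
      rw [pow_succ' 2 k, list_prod_range_two_mul, finset_prod_range_two_mul] at h
      simp only [Nat.mul_mod_right, if_true, h1, one_ne_zero, if_false, List.map_const',
        List.length_range, List.prod_replicate, Finset.prod_const, Finset.card_range, hP, hQ,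
        ← sq, ← pow_mul, ← pow_succ'] at h
      rw [pow_succ' 2 k, pow_mul |((P * Q) ^ (2 ^ k)).trace|, sq_abs] at h
      have hP0 := trace_gram_pow_nonneg P (2 ^ k)
      have hQ0 := trace_gram_pow_nonneg Q (2 ^ k)
      rw [hP, ← sq, ← pow_mul] at hP0
      rw [hQ, ← sq, ← pow_mul] at hQ0
      rw [pow_succ' 2 k]
      exact le_of_pow_le_pow_left₀ (by positivity) (mul_nonneg hP0 hQ0) h
    -- Adjacent factors are paired; `alt` with `P = AᵀA`, `Q = BBᵀ` then separates each pair `AB`.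
    have h := ih fun i => A (2 * i) * A (2 * i + 1)
    rw [pow_succ' 2 (k + 1), list_prod_range_two_mul, finset_prod_range_two_mul, mul_comm 2,
      pow_mul]
    refine (pow_le_pow_left₀ (by positivity) h 2).trans ?_
    rw [← Finset.prod_pow]
    refine Finset.prod_le_prod (fun i _ => by positivity) fun i _ => ?_
    have h1 : (((A (2 * i) * A (2 * i + 1))ᵀ * (A (2 * i) * A (2 * i + 1))) ^ (2 ^ k)).trace =
        ((((A (2 * i))ᵀ * A (2 * i)) * (A (2 * i + 1) * (A (2 * i + 1))ᵀ)) ^ (2 ^ k)).trace := by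
      rw [transpose_mul, mul_assoc, trace_pow_mul_comm]
      simp only [mul_assoc]
    rw [h1, trace_pow_mul_comm (A (2 * i + 1))ᵀ (A (2 * i + 1))]
    exact alt _ _ (by simp) (by simp)

theorem trace_pow_le_trace_gram_pow (M : Matrix n n ℝ) (k : ℕ) :
    (M ^ (2 ^ (k + 1))).trace ≤ ((Mᵀ * M) ^ (2 ^ k)).trace := by
  have h := abs_trace_list_prod_pow_le k fun _ => M
  simp only [List.map_const', List.length_range, List.prod_replicate, Finset.prod_const,
    Finset.card_range] at h
  exact (le_abs_self _).trans
    (le_of_pow_le_pow_left₀ (by positivity) (trace_gram_pow_nonneg M _) h)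

/-- Passing from `XY` to its Gram matrix and cycling the trace halves the exponent and replaces `X,
Y` by `X², Y²`; iterate. -/
theorem trace_mul_pow_two_pow_le {X Y : Matrix n n ℝ} (hX : Xᵀ = X) (hY : Yᵀ = Y) (k : ℕ) :
    ((X * Y) ^ (2 ^ k)).trace ≤ (X ^ (2 ^ k) * Y ^ (2 ^ k)).trace := by
  induction k generalizing X Y with
  | zero => simp
  | succ k ih =>
    refine (trace_pow_le_trace_gram_pow (X * Y) k).trans ?_
    have h1 : (((X * Y)ᵀ * (X * Y)) ^ (2 ^ k)).trace = ((X ^ 2 * Y ^ 2) ^ (2 ^ k)).trace := by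
      rw [transpose_mul, hX, hY, mul_assoc, trace_pow_mul_comm]
      simp only [mul_assoc, sq]
    rw [h1, pow_succ' 2 k, pow_mul, pow_mul]
    exact ih (by rw [transpose_pow, hX]) (by rw [transpose_pow, hY])

end TraceInequalities

end Matrix

/-! ### The Lie–Trotter product formula -/

section LieTrotter

variable {𝔸 : Type*} [NormedRing 𝔸] [NormOneClass 𝔸]

theorem norm_pow_sub_pow_le {X Y : 𝔸} {c : ℝ} (hX : ‖X‖ ≤ c) (hY : ‖Y‖ ≤ c) (N : ℕ) :
    ‖X ^ N - Y ^ N‖ ≤ N * c ^ (N - 1) * ‖X - Y‖ := by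
  have hc : 0 ≤ c := (norm_nonneg _).trans hX
  induction N with
  | zero => simp
  | succ N ih =>
    have h : X ^ (N + 1) - Y ^ (N + 1) = X ^ N * (X - Y) + (X ^ N - Y ^ N) * Y := by
      rw [pow_succ, pow_succ]; noncomm_ring
    have h1 : ‖X ^ N * (X - Y)‖ ≤ c ^ N * ‖X - Y‖ :=
      (norm_mul_le _ _).trans (by
        gcongr; exact (norm_pow_le X N).trans (pow_le_pow_left₀ (norm_nonneg _) hX N))
    have h2 : ‖(X ^ N - Y ^ N) * Y‖ ≤ N * c ^ (N - 1) * ‖X - Y‖ * c :=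
      (norm_mul_le _ _).trans (by gcongr)
    have h3 : (N : ℝ) * c ^ (N - 1) * ‖X - Y‖ * c = N * c ^ N * ‖X - Y‖ := by
      cases N with
      | zero => simp
      | succ N => simp only [Nat.add_sub_cancel, pow_succ]; ring
    rw [h]
    refine (norm_add_le _ _).trans ?_
    push_cast
    linarith

variable [NormedAlgebra ℝ 𝔸] [CompleteSpace 𝔸]

theorem NormedSpace.norm_exp_le_exp_norm (x : 𝔸) : ‖NormedSpace.exp x‖ ≤ Real.exp ‖x‖ := by
  have h := NormedSpace.exp_series_hasSum_exp' (𝕂 := ℝ) x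
  have h' := NormedSpace.exp_series_hasSum_exp' (𝕂 := ℝ) ‖x‖
  rw [← Real.exp_eq_exp_ℝ] at h'
  refine h.norm_le_of_bounded h' fun k => ?_
  rw [norm_smul, smul_eq_mul, Real.norm_of_nonneg (by positivity)]
  gcongr
  exact norm_pow_le x k

open Filter Topology

/-- The Lie–Trotter product formula. -/
theorem NormedSpace.tendsto_exp_mul_exp_pow (A B : 𝔸) :
    Tendsto (fun N : ℕ => (NormedSpace.exp ((N : ℝ)⁻¹ • A) * NormedSpace.exp ((N : ℝ)⁻¹ • B)) ^ N)
      atTop (𝓝 (NormedSpace.exp (A + B))) := by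
  let _ : NormedAlgebra ℚ 𝔸 := NormedAlgebra.restrictScalars ℚ ℝ 𝔸
  -- `F` vanishes to second order at `0`, so `N ‖F (1/N)‖ → 0`; by telescoping, this controls the
  -- difference of the `N`-th powers.
  set F : ℝ → 𝔸 := fun t =>
    NormedSpace.exp (t • A) * NormedSpace.exp (t • B) - NormedSpace.exp (t • (A + B)) with hF
  have hd : HasDerivAt F 0 0 := by
    have h := ((hasDerivAt_exp_smul_const A (0 : ℝ)).mul (hasDerivAt_exp_smul_const B (0 : ℝ))).sub
      (hasDerivAt_exp_smul_const (A + B) (0 : ℝ))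
    exact h.congr_deriv (by simp)
  have hinv : Tendsto (fun N : ℕ => (N : ℝ)⁻¹) atTop (𝓝[≠] 0) :=
    (tendsto_inv_atTop_nhdsGT_zero.comp tendsto_natCast_atTop_atTop).mono_right
      (nhdsWithin_mono _ fun x hx => ne_of_gt hx)
  have hslope := (hd.tendsto_slope_zero.comp hinv).norm
  simp only [Function.comp_def, zero_add, inv_inv, norm_zero] at hslope
  have hF0 : F 0 = 0 := by simp [hF]
  rw [tendsto_iff_norm_sub_tendsto_zero]
  have hub := hslope.const_mul (Real.exp (‖A‖ + ‖B‖))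
  rw [mul_zero] at hub
  refine squeeze_zero' (Eventually.of_forall fun _ => norm_nonneg _) ?_ hub
  filter_upwards [eventually_gt_atTop 0] with N hN
  have hN' : (N : ℝ) ≠ 0 := by positivity
  set s : ℝ := (N : ℝ)⁻¹ with hs
  have hs0 : 0 ≤ s := by positivity
  have hpow : NormedSpace.exp (s • (A + B)) ^ N = NormedSpace.exp (A + B) := by
    rw [← NormedSpace.exp_nsmul, ← Nat.cast_smul_eq_nsmul ℝ, smul_smul, hs,
      mul_inv_cancel₀ hN', one_smul]
  have hX : ‖NormedSpace.exp (s • A) * NormedSpace.exp (s • B)‖ ≤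
      Real.exp (s * (‖A‖ + ‖B‖)) := by
    refine (norm_mul_le _ _).trans ?_
    rw [mul_add, Real.exp_add]
    have h (C : 𝔸) : ‖NormedSpace.exp (s • C)‖ ≤ Real.exp (s * ‖C‖) := by
      simpa [norm_smul, abs_of_nonneg hs0] using NormedSpace.norm_exp_le_exp_norm (s • C)
    exact mul_le_mul (h A) (h B) (norm_nonneg _) (Real.exp_pos _).le
  have hY : ‖NormedSpace.exp (s • (A + B))‖ ≤ Real.exp (s * (‖A‖ + ‖B‖)) := by
    refine (NormedSpace.norm_exp_le_exp_norm _).trans (Real.exp_le_exp.2 ?_)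
    rw [norm_smul, Real.norm_of_nonneg hs0]
    gcongr
    exact norm_add_le A B
  have hc : Real.exp (s * (‖A‖ + ‖B‖)) ^ (N - 1) ≤ Real.exp (‖A‖ + ‖B‖) := by
    rw [← Real.exp_nat_mul]
    refine Real.exp_le_exp.2 ?_
    have h1 : ((N - 1 : ℕ) : ℝ) * s ≤ 1 := by
      rw [hs, ← div_eq_mul_inv, div_le_one (by positivity)]
      exact_mod_cast Nat.sub_le N 1
    rw [← mul_assoc]
    exact mul_le_of_le_one_left (by positivity) h1
  rw [← hpow]
  refine (norm_pow_sub_pow_le hX hY N).trans ?_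
  rw [hF0, sub_zero, norm_smul, Real.norm_of_nonneg (by positivity)]
  calc (N : ℝ) * Real.exp (s * (‖A‖ + ‖B‖)) ^ (N - 1) *
        ‖NormedSpace.exp (s • A) * NormedSpace.exp (s • B) - NormedSpace.exp (s • (A + B))‖
      ≤ N * Real.exp (‖A‖ + ‖B‖) * ‖F s‖ := by gcongr
    _ = Real.exp (‖A‖ + ‖B‖) * (N * ‖F s‖) := by ring

end LieTrotter

/-! ### The Golden–Thompson inequality -/

namespace Matrix

open Filter Topology

/-- The Golden–Thompson inequality. -/
theorem trace_exp_add_le {n : Type*} [Fintype n] [DecidableEq n] {A B : Matrix n n ℝ}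
    (hA : Aᵀ = A) (hB : Bᵀ = B) :
    (NormedSpace.exp (A + B)).trace ≤ (NormedSpace.exp A * NormedSpace.exp B).trace := by
  -- Lie–Trotter is stated for `‖1‖ = 1`, which fails for empty matrices.
  cases isEmpty_or_nonempty n
  · simp [trace]
  -- The trace inequality is available only for exponents `2 ^ k`, and this subsequence suffices.
  have h2 : Tendsto (fun k : ℕ => 2 ^ k) atTop (atTop : Filter ℕ) :=
    tendsto_pow_atTop_atTop_of_one_lt one_lt_two
  have h := (NormedSpace.tendsto_exp_mul_exp_pow A B).comp h2
  have ht : Continuous (fun M : Matrix n n ℝ => M.trace) := continuous_id.matrix_trace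
  refine le_of_tendsto ((ht.tendsto _).comp h) (Eventually.of_forall fun k => ?_)
  have hexp (C : Matrix n n ℝ) :
      NormedSpace.exp (((2 ^ k : ℕ) : ℝ)⁻¹ • C) ^ (2 ^ k) = NormedSpace.exp C := by
    rw [← Matrix.exp_nsmul, ← Nat.cast_smul_eq_nsmul ℝ, smul_smul,
      mul_inv_cancel₀ (by positivity), one_smul]
  have hsymm {C : Matrix n n ℝ} (hC : Cᵀ = C) (s : ℝ) :
      (NormedSpace.exp (s • C))ᵀ = NormedSpace.exp (s • C) := by
    rw [← Matrix.exp_transpose, transpose_smul, hC]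
  have := trace_mul_pow_two_pow_le (hsymm hA ((2 ^ k : ℕ) : ℝ)⁻¹) (hsymm hB ((2 ^ k : ℕ) : ℝ)⁻¹) k
  rwa [hexp, hexp] at this

end Matrix

/-! ### Trace exponential moments and matrix Bernstein -/

namespace Matrix

section ExponentialMoments

variable {n : Type*}

theorem transpose_sum_eq {κ : Type*} {s : Finset κ} {X : κ → Matrix n n ℝ}
    (hX : ∀ i, (X i)ᵀ = X i) : (∑ i ∈ s, X i)ᵀ = ∑ i ∈ s, X i := by
  rw [transpose_sum]
  exact Finset.sum_congr rfl fun i _ => hX i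

variable [Fintype n]

theorem mulVec_dotProduct_eq {m : Type*} [Fintype m] (M : Matrix m n ℝ) (x : n → ℝ) (y : m → ℝ) :
    (M *ᵥ x) ⬝ᵥ y = x ⬝ᵥ (Mᵀ *ᵥ y) := by
  rw [mulVec_transpose, dotProduct_comm, dotProduct_mulVec, dotProduct_comm]

variable [DecidableEq n]

theorem exists_orthogonal_diagonalization {A : Matrix n n ℝ} (hA : Aᵀ = A) :
    ∃ (Q : Matrix n n ℝ) (l : n → ℝ), Qᵀ * Q = 1 ∧ Q * Qᵀ = 1 ∧ A = Q * diagonal l * Qᵀ ∧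
      NormedSpace.exp A = Q * diagonal (fun i => Real.exp (l i)) * Qᵀ := by
  have hH : A.IsHermitian := by rw [IsHermitian, conjTranspose_eq_transpose_of_trivial, hA]
  set Q : Matrix n n ℝ := ↑hH.eigenvectorUnitary with hQ
  have hs : star Q = Qᵀ := by rw [star_eq_conjTranspose, conjTranspose_eq_transpose_of_trivial]
  have h1 : Qᵀ * Q = 1 := by rw [← hs]; exact Unitary.coe_star_mul_self hH.eigenvectorUnitary
  have h2 : Q * Qᵀ = 1 := by rw [← hs]; exact Unitary.coe_mul_star_self hH.eigenvectorUnitary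
  have h3 : A = Q * diagonal hH.eigenvalues * Qᵀ := by
    conv_lhs => rw [hH.spectral_theorem, Unitary.conjStarAlgAut_apply]
    rw [← hs]
    rfl
  refine ⟨Q, hH.eigenvalues, h1, h2, h3, ?_⟩
  have hinv : Q⁻¹ = Qᵀ := inv_eq_right_inv h2
  have hu : IsUnit Q := (isUnit_iff_isUnit_det Q).2 (isUnit_det_of_right_inverse h2)
  have := Matrix.exp_conj Q (diagonal hH.eigenvalues) hu
  rw [hinv, ← h3, exp_diagonal] at this
  rw [this]
  congr 3
  ext i
  rw [Pi.coe_exp, Real.exp_eq_exp_ℝ]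

theorem dotProduct_conj_diagonal_mulVec (Q : Matrix n n ℝ) (l x : n → ℝ) :
    x ⬝ᵥ ((Q * diagonal l * Qᵀ) *ᵥ x) = ∑ i, l i * (Qᵀ *ᵥ x) i ^ 2 := by
  rw [← mulVec_mulVec, ← mulVec_mulVec, dotProduct_comm, mulVec_dotProduct_eq]
  simp only [dotProduct, mulVec_diagonal]
  exact Finset.sum_congr rfl fun i _ => by ring

theorem dotProduct_eq_sum_sq {m : Type*} [Fintype m] {Q : Matrix m n ℝ} (hQ : Qᵀ * Q = 1)
    (x : n → ℝ) : x ⬝ᵥ x = ∑ i, (Q *ᵥ x) i ^ 2 := by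
  have : (Q *ᵥ x) ⬝ᵥ (Q *ᵥ x) = x ⬝ᵥ x := by
    rw [mulVec_dotProduct_eq, mulVec_mulVec, hQ, one_mulVec]
  rw [← this]
  simp [dotProduct, sq]

/-- A Rayleigh quotient above `c` forces an eigenvalue at least `c`, and the trace dominates each
`exp (l i)`. This is the Markov step of the Bernstein bound. -/
theorem exp_le_trace_exp {A : Matrix n n ℝ} (hA : Aᵀ = A) {c : ℝ} {x : n → ℝ}
    (hx : c * (x ⬝ᵥ x) < x ⬝ᵥ (A *ᵥ x)) : Real.exp c ≤ (NormedSpace.exp A).trace := by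
  obtain ⟨Q, l, h1, h2, h3, h4⟩ := exists_orthogonal_diagonalization hA
  rw [h4, trace_mul_comm, ← mul_assoc, h1, one_mul, trace_diagonal]
  rw [h3, dotProduct_conj_diagonal_mulVec, dotProduct_eq_sum_sq (Q := Qᵀ) (by simpa using h2),
    Finset.mul_sum] at hx
  obtain ⟨i, -, hi⟩ := Finset.exists_lt_of_sum_lt hx
  have hci : c ≤ l i := by
    by_contra! h
    exact absurd hi (not_lt.2 (mul_le_mul_of_nonneg_right h.le (sq_nonneg _)))
  exact (Real.exp_le_exp.2 hci).trans
    (Finset.single_le_sum (f := fun i => Real.exp (l i)) (fun i _ => (Real.exp_pos _).le)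
      (Finset.mem_univ i))

theorem trace_exp_nonneg {A : Matrix n n ℝ} (hA : Aᵀ = A) : 0 ≤ (NormedSpace.exp A).trace := by
  obtain ⟨Q, l, h1, h2, h3, h4⟩ := exists_orthogonal_diagonalization hA
  rw [h4, trace_mul_comm, ← mul_assoc, h1, one_mul, trace_diagonal]
  exact Finset.sum_nonneg fun i _ => (Real.exp_pos _).le

/-- In an eigenbasis of `A` the trace is a sum of diagonal entries of `M`, each at most `c`, with
positive weights `exp (l i)`. -/
theorem trace_exp_mul_le {A M : Matrix n n ℝ} (hA : Aᵀ = A) {c : ℝ}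
    (hM : ∀ x, x ⬝ᵥ (M *ᵥ x) ≤ c * (x ⬝ᵥ x)) :
    (NormedSpace.exp A * M).trace ≤ c * (NormedSpace.exp A).trace := by
  obtain ⟨Q, l, h1, h2, h3, h4⟩ := exists_orthogonal_diagonalization hA
  have ht : (NormedSpace.exp A).trace = ∑ i, Real.exp (l i) := by
    rw [h4, trace_mul_comm, ← mul_assoc, h1, one_mul, trace_diagonal]
  have hm : (NormedSpace.exp A * M).trace = ∑ i, Real.exp (l i) * (Qᵀ * M * Q) i i := by
    rw [h4, mul_assoc, mul_assoc, trace_mul_comm, mul_assoc, trace]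
    simp [diagonal_mul, mul_assoc]
  rw [ht, hm, Finset.mul_sum]
  refine Finset.sum_le_sum fun i _ => ?_
  rw [mul_comm c]
  gcongr
  have h := hM (Q.col i)
  have e1 : Q.col i ⬝ᵥ Q.col i = 1 := by
    have := congrFun (congrFun h1 i) i
    rwa [one_apply_eq] at this
  have e2 : (Qᵀ * M * Q) i i = Q.col i ⬝ᵥ (M *ᵥ Q.col i) := by
    rw [mul_assoc]
    rfl
  rwa [e1, mul_one, ← e2] at h

/-- The scalar bound `exp s ≤ 1 + s + s²` for `|s| ≤ 1`, applied to each eigenvalue. -/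
theorem dotProduct_exp_mulVec_le {X : Matrix n n ℝ} (hX : Xᵀ = X)
    (hb : ∀ x, |x ⬝ᵥ (X *ᵥ x)| ≤ x ⬝ᵥ x) (x : n → ℝ) :
    x ⬝ᵥ (NormedSpace.exp X *ᵥ x) ≤ x ⬝ᵥ x + x ⬝ᵥ (X *ᵥ x) + x ⬝ᵥ ((X * X) *ᵥ x) := by
  obtain ⟨Q, l, h1, h2, h3, h4⟩ := exists_orthogonal_diagonalization hX
  have h5 : X * X = Q * diagonal (fun i => l i ^ 2) * Qᵀ := by
    have : X * X = Q * diagonal l * (Qᵀ * Q) * diagonal l * Qᵀ := by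
      conv_lhs => rw [h3]
      simp only [mul_assoc]
    rw [this, h1, mul_one, mul_assoc Q, diagonal_mul_diagonal]
    simp only [sq]
  have hl (i : n) : |l i| ≤ 1 := by
    have h := hb (Q *ᵥ Pi.single i 1)
    rw [dotProduct_eq_sum_sq (Q := Qᵀ) (by simpa using h2), h3, dotProduct_conj_diagonal_mulVec,
      mulVec_mulVec, h1, one_mulVec] at h
    simpa [Pi.single_apply] using h
  rw [h5, h4, dotProduct_eq_sum_sq (Q := Qᵀ) (by simpa using h2) x]
  conv_rhs => rw [h3]
  simp only [dotProduct_conj_diagonal_mulVec, ← Finset.sum_add_distrib]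
  refine Finset.sum_le_sum fun i _ => ?_
  have h := (abs_le.1 (Real.abs_exp_sub_one_sub_id_le (hl i))).2
  nlinarith [sq_nonneg ((Qᵀ *ᵥ x) i)]

variable {ι : Type*} [Fintype ι]

/-- The Ahlswede–Winter bound for the trace exponential moment of a sum of `r` independent
identically distributed symmetric matrices. -/
theorem sum_trace_exp_le {p : ι → ℝ} (hp : ∀ i, 0 ≤ p i) {X : ι → Matrix n n ℝ}
    (hX : ∀ i, (X i)ᵀ = X i) {c : ℝ} (hc : 0 ≤ c)
    (hM : ∀ x, x ⬝ᵥ ((∑ i, p i • NormedSpace.exp (X i)) *ᵥ x) ≤ c * (x ⬝ᵥ x)) (r : ℕ)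
    {H : Matrix n n ℝ} (hH : Hᵀ = H) :
    ∑ t : Fin r → ι, (∏ j, p (t j)) * (NormedSpace.exp (H + ∑ j, X (t j))).trace ≤
      c ^ r * (NormedSpace.exp H).trace := by
  -- `H` must vary: the first draw is absorbed into it, the remaining draws are summed out, and
  -- Golden–Thompson then splits `X i` off again.
  induction r generalizing H with
  | zero => simp
  | succ r ih =>
    rw [← (Fin.consEquiv fun _ => ι).sum_comp, Fintype.sum_prod_type]
    calc _ = ∑ i, p i * ∑ t : Fin r → ι, (∏ j, p (t j)) *
          (NormedSpace.exp ((H + X i) + ∑ j, X (t j))).trace := by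
          simp [Fin.consEquiv, Fin.prod_univ_succ, Fin.sum_univ_succ, Finset.mul_sum, add_assoc,
            mul_assoc]
      _ ≤ ∑ i, p i * (c ^ r * (NormedSpace.exp H * NormedSpace.exp (X i)).trace) := by
          refine Finset.sum_le_sum fun i _ => mul_le_mul_of_nonneg_left ?_ (hp i)
          refine (ih (by rw [transpose_add, hH, hX])).trans ?_
          gcongr
          exact trace_exp_add_le hH (hX i)
      _ = c ^ r * (NormedSpace.exp H * ∑ i, p i • NormedSpace.exp (X i)).trace := by
          simp only [Finset.mul_sum, trace_sum, mul_smul_comm, trace_smul, smul_eq_mul]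
          exact Finset.sum_congr rfl fun i _ => by ring
      _ ≤ c ^ r * (c * (NormedSpace.exp H).trace) := by
          gcongr
          exact trace_exp_mul_le hH hM
      _ = _ := by ring

open Classical in
/-- A matrix Bernstein inequality, as a bound for the total weight of the samples for which the
quadratic form of the sum exceeds `s` somewhere on the unit sphere. -/
theorem sum_weight_lt_le {p : ι → ℝ} (hp : ∀ i, 0 ≤ p i) (hp1 : ∑ i, p i = 1)
    {X : ι → Matrix n n ℝ} (hX : ∀ i, (X i)ᵀ = X i) (hmean : ∑ i, p i • X i = 0) {L θ s : ℝ}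
    (hθ : 0 < θ) (hb : ∀ i x, θ * |x ⬝ᵥ (X i *ᵥ x)| ≤ x ⬝ᵥ x)
    (hvar : ∀ x, x ⬝ᵥ ((∑ i, p i • (X i * X i)) *ᵥ x) ≤ L * (x ⬝ᵥ x)) (r : ℕ) :
    ∑ t : Fin r → ι, (if ∃ x, s * (x ⬝ᵥ x) < x ⬝ᵥ ((∑ j, X (t j)) *ᵥ x) then ∏ j, p (t j) else 0) ≤
      Fintype.card n * Real.exp (r * (θ ^ 2 * L) - θ * s) := by
  have hθX (i : ι) : (θ • X i)ᵀ = θ • X i := by rw [transpose_smul, hX]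
  -- The linear term averages to zero, leaving `1 + θ²L ≤ exp (θ²L)`.
  have hmgf (x : n → ℝ) : x ⬝ᵥ ((∑ i, p i • NormedSpace.exp (θ • X i)) *ᵥ x) ≤
      Real.exp (θ ^ 2 * L) * (x ⬝ᵥ x) := by
    have hx0 : 0 ≤ x ⬝ᵥ x := by simpa using dotProduct_star_self_nonneg x
    have h1 : x ⬝ᵥ ((∑ i, p i • X i) *ᵥ x) = 0 := by simp [hmean]
    have h2 := hvar x
    simp only [sum_mulVec, dotProduct_sum, smul_mulVec, dotProduct_smul, smul_eq_mul]
      at h1 h2 ⊢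
    calc ∑ i, p i * (x ⬝ᵥ (NormedSpace.exp (θ • X i) *ᵥ x))
        ≤ ∑ i, p i * (x ⬝ᵥ x + θ * (x ⬝ᵥ (X i *ᵥ x)) + θ ^ 2 * (x ⬝ᵥ ((X i * X i) *ᵥ x))) := by
          refine Finset.sum_le_sum fun i _ => mul_le_mul_of_nonneg_left ?_ (hp i)
          refine (dotProduct_exp_mulVec_le (hθX i) (fun y => ?_) x).trans_eq ?_
          · rw [smul_mulVec, dotProduct_smul, smul_eq_mul, abs_mul, abs_of_pos hθ]
            exact hb i y
          · simp only [smul_mulVec, dotProduct_smul, smul_eq_mul, smul_mul_smul_comm, sq]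
      _ = (∑ i, p i) * (x ⬝ᵥ x) + θ * ∑ i, p i * (x ⬝ᵥ (X i *ᵥ x)) +
            θ ^ 2 * ∑ i, p i * (x ⬝ᵥ ((X i * X i) *ᵥ x)) := by
          rw [Finset.sum_mul, Finset.mul_sum, Finset.mul_sum, ← Finset.sum_add_distrib,
            ← Finset.sum_add_distrib]
          exact Finset.sum_congr rfl fun i _ => by ring
      _ ≤ (θ ^ 2 * L + 1) * (x ⬝ᵥ x) := by
          rw [hp1, h1]
          nlinarith [sq_nonneg θ]
      _ ≤ _ := by
          gcongr
          exact Real.add_one_le_exp _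
  have hmom := sum_trace_exp_le hp hθX (Real.exp_pos _).le hmgf r (H := 0) (by simp)
  simp only [zero_add, NormedSpace.exp_zero, trace_one, ← Real.exp_nat_mul] at hmom
  calc _ ≤ ∑ t : Fin r → ι, Real.exp (-(θ * s)) *
        ((∏ j, p (t j)) * (NormedSpace.exp (∑ j, θ • X (t j))).trace) := by
        refine Finset.sum_le_sum fun t _ => ?_
        have hw : 0 ≤ ∏ j, p (t j) := Finset.prod_nonneg fun j _ => hp _
        have hsym : (∑ j, θ • X (t j))ᵀ = ∑ j, θ • X (t j) := transpose_sum_eq fun j => hθX (t j)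
        split_ifs with h
        · obtain ⟨x, hx⟩ := h
          have h1 := exp_le_trace_exp hsym (c := θ * s) (x := x) (by
            rw [← Finset.smul_sum, smul_mulVec, dotProduct_smul, smul_eq_mul, mul_assoc]
            exact mul_lt_mul_of_pos_left hx hθ)
          calc ∏ j, p (t j) = Real.exp (-(θ * s)) * ((∏ j, p (t j)) * Real.exp (θ * s)) := by
                rw [mul_left_comm, ← Real.exp_add, neg_add_cancel, Real.exp_zero, mul_one]
            _ ≤ _ := by gcongr
        · exact mul_nonneg (Real.exp_pos _).le (mul_nonneg hw (trace_exp_nonneg hsym))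
    _ ≤ Real.exp (-(θ * s)) * (Real.exp (r * (θ ^ 2 * L)) * Fintype.card n) := by
        rw [← Finset.mul_sum]
        gcongr
    _ = _ := by rw [sub_eq_add_neg, Real.exp_add]; ring

end ExponentialMoments

end Matrix

/-! ### Deterministic reconstruction from a Gram matrix approximation -/

section Deterministic

open Matrix

theorem dotProduct_self_nonneg_real {n : Type*} [Fintype n] (x : n → ℝ) : 0 ≤ x ⬝ᵥ x := by
  simpa using dotProduct_star_self_nonneg x

theorem norm_toLp_sq {n : Type*} [Fintype n] (x : n → ℝ) : ‖WithLp.toLp 2 x‖ ^ 2 = x ⬝ᵥ x := by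
  rw [EuclideanSpace.norm_sq_eq]
  simp [dotProduct, sq]

variable {m d r k : ℕ}

theorem mulVec_dotProduct_self_le (M : Matrix (Fin m) (Fin d) ℝ) (x : Fin d → ℝ) :
    (M *ᵥ x) ⬝ᵥ (M *ᵥ x) ≤ ‖M‖ ^ 2 * (x ⬝ᵥ x) := by
  rw [← norm_toLp_sq, ← norm_toLp_sq, ← mul_pow]
  exact pow_le_pow_left₀ (norm_nonneg _) (l2_opNorm_mulVec M (WithLp.toLp 2 x)) 2

theorem l2_opNorm_le_of_dotProduct_self_le (M : Matrix (Fin m) (Fin d) ℝ) {c : ℝ} (hc : 0 ≤ c)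
    (h : ∀ x, (M *ᵥ x) ⬝ᵥ (M *ᵥ x) ≤ c ^ 2 * (x ⬝ᵥ x)) : ‖M‖ ≤ c := by
  rw [l2_opNorm_def]
  refine ContinuousLinearMap.opNorm_le_bound _ hc fun x => ?_
  have := h x.ofLp
  rw [← norm_toLp_sq, ← norm_toLp_sq, ← mul_pow] at this
  exact le_of_sq_le_sq this (by positivity)

theorem transpose_mul_self_of_mem_orthogonalGroup {V : Matrix (Fin d) (Fin d) ℝ}
    (hV : V ∈ orthogonalGroup (Fin d) ℝ) : Vᵀ * V = 1 :=
  (mem_orthogonalGroup_iff' (Fin d) ℝ).1 hV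

theorem mul_transpose_self_of_mem_orthogonalGroup {V : Matrix (Fin d) (Fin d) ℝ}
    (hV : V ∈ orthogonalGroup (Fin d) ℝ) : V * Vᵀ = 1 :=
  (mem_orthogonalGroup_iff (Fin d) ℝ).1 hV

theorem rectDiagonal_gram {σ : Fin d → ℝ} (hσ : ∀ i : Fin d, r ≤ (i : ℕ) → σ i = 0) :
    (rectDiagonal r σ)ᵀ * rectDiagonal r σ = diagonal fun i => σ i ^ 2 := by
  ext i j
  rw [mul_apply, diagonal_apply]
  simp only [rectDiagonal, transpose_apply, of_apply]
  split_ifs with hij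
  · subst hij
    by_cases hi : (i : ℕ) < r
    · rw [Finset.sum_eq_single ⟨i, hi⟩]
      · simp [sq]
      · intro a _ ha
        rw [if_neg fun h => ha (Fin.ext h), zero_mul]
      · simp
    · rw [hσ i (not_lt.1 hi)]
      simp
  · refine Finset.sum_eq_zero fun a _ => ?_
    by_cases h : (a : ℕ) = i
    · rw [if_neg (c := (a : ℕ) = j) fun h' => hij (Fin.ext (h.symm.trans h')), mul_zero]
    · rw [if_neg h, zero_mul]

theorem IsFullSVD.mulVec_dotProduct_self {M : Matrix (Fin r) (Fin d) ℝ}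
    {U : Matrix (Fin r) (Fin r) ℝ} {σ : Fin d → ℝ} {V : Matrix (Fin d) (Fin d) ℝ}
    (h : IsFullSVD M U σ V) (x : Fin d → ℝ) :
    (M *ᵥ x) ⬝ᵥ (M *ᵥ x) = ∑ i, σ i ^ 2 * (Vᵀ *ᵥ x) i ^ 2 := by
  have hg : Mᵀ * M = V * diagonal (fun i => σ i ^ 2) * Vᵀ := by
    have hU := transpose_mul_self_of_mem_orthogonalGroup h.orthogonal_left
    calc Mᵀ * M = V * (rectDiagonal r σ)ᵀ * (Uᵀ * U) * rectDiagonal r σ * Vᵀ := by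
          rw [h.eq]
          simp only [transpose_mul, transpose_transpose, Matrix.mul_assoc]
      _ = _ := by
          rw [hU, Matrix.mul_one, Matrix.mul_assoc V, rectDiagonal_gram h.padding]
  rw [mulVec_dotProduct_eq, mulVec_mulVec, hg, dotProduct_conj_diagonal_mulVec]

theorem firstCols_one_mulVec (hk : k ≤ d) (z : Fin k → ℝ) (i : Fin d) :
    (firstCols (1 : Matrix (Fin d) (Fin d) ℝ) hk *ᵥ z) i =
      if h : (i : ℕ) < k then z ⟨i, h⟩ else 0 := by
  simp only [mulVec, dotProduct, firstCols, submatrix_apply, id, one_apply, ite_mul, one_mul,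
    zero_mul]
  split_ifs with h
  · rw [Finset.sum_eq_single ⟨i, h⟩]
    · simp
    · intro a _ ha
      rw [if_neg]
      rintro rfl
      exact ha rfl
    · simp
  · refine Finset.sum_eq_zero fun a _ => if_neg ?_
    rintro rfl
    exact h a.2

theorem transpose_mul_firstCols {V : Matrix (Fin d) (Fin d) ℝ} (hV : Vᵀ * V = 1) (hk : k ≤ d) :
    Vᵀ * firstCols V hk = firstCols 1 hk := by
  rw [← hV]
  rfl

theorem topProjection_self {V : Matrix (Fin d) (Fin d) ℝ} (hV : V * Vᵀ = 1) (hk : d ≤ d) :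
    topProjection V hk = 1 := by
  rw [← hV]
  rfl

theorem transpose_mulVec_sub_topProjection {V : Matrix (Fin d) (Fin d) ℝ} (hV : Vᵀ * V = 1)
    (hk : k ≤ d) (x : Fin d → ℝ) (i : Fin d) :
    (Vᵀ *ᵥ (x - topProjection V hk *ᵥ x)) i = if (i : ℕ) < k then 0 else (Vᵀ *ᵥ x) i := by
  rw [mulVec_sub, topProjection, mulVec_mulVec, ← Matrix.mul_assoc, transpose_mul_firstCols hV,
    ← mulVec_mulVec, Pi.sub_apply, firstCols_one_mulVec]
  split_ifs with h
  · exact sub_self _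
  · exact sub_zero _

/-- If the Gram matrices of `A` and `B` agree up to relative error `ε`, then projecting onto the
top `k` right singular vectors of `B` is almost as good as the best rank-`k` approximation of `A`. -/
theorem norm_sub_mul_topProjection_le {A U : Matrix (Fin m) (Fin d) ℝ} {σ : Fin d → ℝ}
    {V : Matrix (Fin d) (Fin d) ℝ} {B : Matrix (Fin r) (Fin d) ℝ} {ε : ℝ} (hε₀ : 0 < ε)
    (hε₁ : ε < 1)
    (hlow : ∀ x, (1 - ε) * ((A *ᵥ x) ⬝ᵥ (A *ᵥ x)) ≤ (B *ᵥ x) ⬝ᵥ (B *ᵥ x))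
    (hupp : ∀ x, (B *ᵥ x) ⬝ᵥ (B *ᵥ x) ≤ (1 + ε) * ((A *ᵥ x) ⬝ᵥ (A *ᵥ x)))
    {U' : Matrix (Fin r) (Fin r) ℝ} {σ' : Fin d → ℝ} {V' : Matrix (Fin d) (Fin d) ℝ}
    (hB : IsFullSVD B U' σ' V') (hk : k ≤ d) :
    ‖A - A * topProjection V' hk‖ ≤ √((1 + ε) / (1 - ε)) * ‖A - truncatedSVD U σ V hk‖ := by
  have hV := transpose_mul_self_of_mem_orthogonalGroup hB.orthogonal_right
  have hV' := mul_transpose_self_of_mem_orthogonalGroup hB.orthogonal_right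
  -- For `k = d` the projection is the identity and there is no singular value of index `k + 1`.
  obtain rfl | hkd := hk.eq_or_lt
  · rw [topProjection_self hV', Matrix.mul_one, sub_self, norm_zero]
    positivity
  set C := A - truncatedSVD U σ V hk with hC
  let κ : Fin d := ⟨k, hkd⟩
  have hnorm (x : Fin d → ℝ) : x ⬝ᵥ x = ∑ i, (V'ᵀ *ᵥ x) i ^ 2 :=
    dotProduct_eq_sum_sq (by simpa using hV') x
  -- The residual has no component along the first `k` right singular vectors, so only singular
  -- values from the zero-based index `k` on act on it.
  have hres (x : Fin d → ℝ) : (B *ᵥ (x - topProjection V' hk *ᵥ x)) ⬝ᵥ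
      (B *ᵥ (x - topProjection V' hk *ᵥ x)) ≤ σ' κ ^ 2 * (x ⬝ᵥ x) := by
    rw [hB.mulVec_dotProduct_self, hnorm, Finset.mul_sum]
    refine Finset.sum_le_sum fun i _ => ?_
    rw [transpose_mulVec_sub_topProjection hV]
    split_ifs with h
    · rw [zero_pow two_ne_zero, mul_zero]
      positivity
    · gcongr
      · exact hB.nonneg i
      · exact hB.antitone (show κ ≤ i from not_lt.1 h)
  have hσ : σ' κ ^ 2 ≤ (1 + ε) * ‖C‖ ^ 2 := by
    -- Dimension count: a map from dimension `k + 1` to dimension `k` has a kernel, so the span of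
    -- the top `k + 1` right singular vectors of `B` contains some `x ≠ 0` with `Vₖᵀx = 0`. There
    -- `C` agrees with `A`.
    have hker := LinearMap.ker_ne_bot_of_finrank_lt
      (f := ((firstCols V hk)ᵀ * firstCols V' hkd).mulVecLin) (by simp)
    obtain ⟨z, hz, hz0⟩ := (Submodule.ne_bot_iff _).1 hker
    rw [LinearMap.mem_ker, mulVecLin_apply] at hz
    set x := firstCols V' hkd *ᵥ z with hx
    have hw (i : Fin d) : (V'ᵀ *ᵥ x) i = if h : (i : ℕ) < k + 1 then z ⟨i, h⟩ else 0 := by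
      rw [hx, mulVec_mulVec, transpose_mul_firstCols hV, firstCols_one_mulVec]
    have hx0 : 0 < x ⬝ᵥ x := by
      obtain ⟨a, ha⟩ := Function.ne_iff.1 hz0
      rw [hnorm]
      refine Finset.sum_pos' (fun i _ => sq_nonneg _) ⟨Fin.castLE hkd a, Finset.mem_univ _, ?_⟩
      rw [hw, dif_pos (show ((Fin.castLE hkd a : Fin d) : ℕ) < k + 1 from a.2)]
      exact sq_pos_of_ne_zero ha
    have hCx : C *ᵥ x = A *ᵥ x := by
      have : truncatedSVD U σ V hk *ᵥ x = 0 := by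
        rw [truncatedSVD, ← mulVec_mulVec, hx, mulVec_mulVec _ (firstCols V hk)ᵀ, hz, mulVec_zero]
      rw [hC, sub_mulVec, this, sub_zero]
    have hBx : σ' κ ^ 2 * (x ⬝ᵥ x) ≤ (B *ᵥ x) ⬝ᵥ (B *ᵥ x) := by
      rw [hB.mulVec_dotProduct_self, hnorm, Finset.mul_sum]
      refine Finset.sum_le_sum fun i _ => ?_
      by_cases h : (i : ℕ) < k + 1
      · gcongr
        · exact hB.nonneg κ
        · exact hB.antitone (show i ≤ κ from Nat.lt_succ_iff.1 h)
      · rw [hw, dif_neg h]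
        simp
    refine le_of_mul_le_mul_right ?_ hx0
    calc σ' κ ^ 2 * (x ⬝ᵥ x) ≤ (1 + ε) * ((A *ᵥ x) ⬝ᵥ (A *ᵥ x)) := hBx.trans (hupp x)
      _ ≤ (1 + ε) * (‖C‖ ^ 2 * (x ⬝ᵥ x)) := by
          rw [← hCx]
          gcongr
          exact mulVec_dotProduct_self_le C x
      _ = _ := by ring
  have hε : 0 < 1 - ε := sub_pos.2 hε₁
  refine l2_opNorm_le_of_dotProduct_self_le _ (by positivity) fun x => ?_
  rw [mul_pow, Real.sq_sqrt (by positivity), sub_mulVec, ← mulVec_mulVec, ← mulVec_sub]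
  refine le_of_mul_le_mul_left ?_ hε
  calc _ ≤ σ' κ ^ 2 * (x ⬝ᵥ x) := (hlow _).trans (hres x)
    _ ≤ (1 + ε) * ‖C‖ ^ 2 * (x ⬝ᵥ x) := by
        gcongr
        exact dotProduct_self_nonneg_real x
    _ = _ := by field_simp

end Deterministic

/-! ### Concentration of the sampled Gram matrix -/

section RowSampling

open Matrix

variable {m d r : ℕ}

/-- The centred summand `u_i u_iᵀ / p_i - 1` of the sampled Gram matrix. -/
noncomputable def centredRowGram (p : Fin m → ℝ) (U : Matrix (Fin m) (Fin d) ℝ) (i : Fin m) :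
    Matrix (Fin d) (Fin d) ℝ :=
  (p i)⁻¹ • vecMulVec (U i) (U i) - 1

theorem centredRowGram_transpose (p : Fin m → ℝ) (U : Matrix (Fin m) (Fin d) ℝ) (i : Fin m) :
    (centredRowGram p U i)ᵀ = centredRowGram p U i := by
  rw [centredRowGram, transpose_sub, transpose_smul, transpose_vecMulVec, transpose_one]

theorem centredRowGram_mulVec (p : Fin m → ℝ) (U : Matrix (Fin m) (Fin d) ℝ) (i : Fin m)
    (x : Fin d → ℝ) :
    centredRowGram p U i *ᵥ x = ((p i)⁻¹ * (U i ⬝ᵥ x)) • U i - x := by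
  rw [centredRowGram, sub_mulVec, smul_mulVec, vecMulVec_mulVec, one_mulVec, op_smul_eq_smul,
    smul_smul]

theorem dotProduct_centredRowGram_mulVec (p : Fin m → ℝ) (U : Matrix (Fin m) (Fin d) ℝ)
    (i : Fin m) (x : Fin d → ℝ) :
    x ⬝ᵥ (centredRowGram p U i *ᵥ x) = (p i)⁻¹ * (U i ⬝ᵥ x) ^ 2 - x ⬝ᵥ x := by
  rw [centredRowGram_mulVec, dotProduct_sub, dotProduct_smul, smul_eq_mul, dotProduct_comm x (U i)]
  ring

theorem sq_dotProduct_le {n : Type*} [Fintype n] (x y : n → ℝ) :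
    (x ⬝ᵥ y) ^ 2 ≤ (x ⬝ᵥ x) * (y ⬝ᵥ y) := by
  have := Finset.sum_mul_sq_le_sq_mul_sq Finset.univ x y
  simpa [dotProduct, sq] using this

theorem rowSamplingMatrix_mulVec_sq {p : Fin m → ℝ} (hp₀ : ∀ i, 0 ≤ p i) (hr : r ≠ 0)
    (t : Fin r → Fin m) (U : Matrix (Fin m) (Fin d) ℝ) (x : Fin d → ℝ) :
    (rowSamplingMatrix p t *ᵥ (U *ᵥ x)) ⬝ᵥ (rowSamplingMatrix p t *ᵥ (U *ᵥ x)) - x ⬝ᵥ x =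
      (r : ℝ)⁻¹ * (x ⬝ᵥ ((∑ j, centredRowGram p U (t j)) *ᵥ x)) := by
  have hr' : (r : ℝ) ≠ 0 := Nat.cast_ne_zero.2 hr
  have h (j : Fin r) : (rowSamplingMatrix p t *ᵥ (U *ᵥ x)) j * (rowSamplingMatrix p t *ᵥ (U *ᵥ x)) j =
      (r : ℝ)⁻¹ * ((p (t j))⁻¹ * (U (t j) ⬝ᵥ x) ^ 2) := by
    have : (rowSamplingMatrix p t *ᵥ (U *ᵥ x)) j = 1 / √((r : ℝ) * p (t j)) * (U (t j) ⬝ᵥ x) := by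
      simp [rowSamplingMatrix, mulVec, dotProduct]
    rw [this, ← sq, mul_pow, div_pow, Real.sq_sqrt (mul_nonneg r.cast_nonneg (hp₀ _)), one_pow,
      one_div, mul_inv, mul_assoc]
  rw [sum_mulVec, dotProduct_sum]
  simp only [dotProduct_centredRowGram_mulVec]
  rw [Finset.sum_sub_distrib, dotProduct]
  simp only [h]
  rw [← Finset.mul_sum, Finset.sum_const, Finset.card_univ, Fintype.card_fin, nsmul_eq_mul, mul_sub,
    inv_mul_cancel_left₀ hr']

variable {U : Matrix (Fin m) (Fin d) ℝ} {p : Fin m → ℝ} {L : ℝ}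

theorem row_eq_zero_of_prob_eq_zero (hp : ∀ i, U i ⬝ᵥ U i ≤ (L + 1) * p i) {i : Fin m}
    (hi : p i = 0) : U i = 0 := by
  have h := hp i
  rw [hi, mul_zero] at h
  exact dotProduct_self_eq_zero.1 (h.antisymm (dotProduct_self_nonneg_real _))

theorem sum_sq_row_dotProduct (hU : Uᵀ * U = 1) (x : Fin d → ℝ) :
    ∑ i, (U i ⬝ᵥ x) ^ 2 = x ⬝ᵥ x :=
  (dotProduct_eq_sum_sq hU x).symm

/-- Rows of probability zero vanish, so the convention `0⁻¹ = 0` loses nothing in expectations. -/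
theorem prob_mul_inv_smul_row (hp : ∀ i, U i ⬝ᵥ U i ≤ (L + 1) * p i) (i : Fin m) :
    (p i * (p i)⁻¹) • U i = U i := by
  by_cases hi : p i = 0
  · rw [row_eq_zero_of_prob_eq_zero hp hi, smul_zero]
  · rw [mul_inv_cancel₀ hi, one_smul]

theorem sum_smul_centredRowGram (hU : Uᵀ * U = 1) (hp₁ : ∑ i, p i = 1)
    (hp : ∀ i, U i ⬝ᵥ U i ≤ (L + 1) * p i) : ∑ i, p i • centredRowGram p U i = 0 := by
  have h1 : ∑ i, vecMulVec (U i) (U i) = 1 := by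
    rw [← hU]
    ext a b
    simp [Matrix.sum_apply, vecMulVec_apply, mul_apply]
  simp only [centredRowGram, smul_sub, Finset.sum_sub_distrib, ← Finset.sum_smul, hp₁, one_smul,
    smul_smul, ← smul_vecMulVec, prob_mul_inv_smul_row hp, h1, sub_self]

theorem inv_mul_sq_row_dotProduct_le (hp₀ : ∀ i, 0 ≤ p i) (hL : 0 ≤ L)
    (hp : ∀ i, U i ⬝ᵥ U i ≤ (L + 1) * p i) (i : Fin m) (x : Fin d → ℝ) :
    (p i)⁻¹ * (U i ⬝ᵥ x) ^ 2 ≤ (L + 1) * (x ⬝ᵥ x) := by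
  have hx := dotProduct_self_nonneg_real x
  obtain hi | hi := (hp₀ i).eq_or_lt
  · rw [← hi, _root_.inv_zero, zero_mul]
    positivity
  · rw [inv_mul_le_iff₀ hi]
    calc _ ≤ _ := sq_dotProduct_le _ _
      _ ≤ (L + 1) * p i * (x ⬝ᵥ x) := mul_le_mul_of_nonneg_right (hp i) hx
      _ = _ := by ring

/-- The form lies between `-1` and `L` on unit vectors; `1 ≤ L` makes the bound two-sided. -/
theorem abs_dotProduct_centredRowGram_le (hp₀ : ∀ i, 0 ≤ p i) (hL : 1 ≤ L)
    (hp : ∀ i, U i ⬝ᵥ U i ≤ (L + 1) * p i) (i : Fin m) (x : Fin d → ℝ) :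
    |x ⬝ᵥ (centredRowGram p U i *ᵥ x)| ≤ L * (x ⬝ᵥ x) := by
  have hx := dotProduct_self_nonneg_real x
  have h1 := inv_mul_sq_row_dotProduct_le hp₀ (by linarith) hp i x
  have h2 : 0 ≤ (p i)⁻¹ * (U i ⬝ᵥ x) ^ 2 := mul_nonneg (inv_nonneg.2 (hp₀ i)) (sq_nonneg _)
  rw [dotProduct_centredRowGram_mulVec, abs_le]
  constructor <;> nlinarith

/-- The second moment is `∑ (‖u‖²/p) uuᵀ - 1`, and `‖u‖²/p ≤ L + 1` where `p > 0`; centring is what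
improves `L + 1` to `L`. -/
theorem dotProduct_sum_sq_centredRowGram_le (hU : Uᵀ * U = 1) (hp₀ : ∀ i, 0 ≤ p i)
    (hp₁ : ∑ i, p i = 1) (hp : ∀ i, U i ⬝ᵥ U i ≤ (L + 1) * p i) (x : Fin d → ℝ) :
    x ⬝ᵥ ((∑ i, p i • (centredRowGram p U i * centredRowGram p U i)) *ᵥ x) ≤ L * (x ⬝ᵥ x) := by
  simp only [sum_mulVec, dotProduct_sum, smul_mulVec, dotProduct_smul, smul_eq_mul]
  calc _ ≤ ∑ i, ((L - 1) * (U i ⬝ᵥ x) ^ 2 + p i * (x ⬝ᵥ x)) := by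
        refine Finset.sum_le_sum fun i _ => ?_
        have e : x ⬝ᵥ ((centredRowGram p U i * centredRowGram p U i) *ᵥ x) =
            (p i)⁻¹ ^ 2 * (U i ⬝ᵥ x) ^ 2 * (U i ⬝ᵥ U i) - 2 * ((p i)⁻¹ * (U i ⬝ᵥ x) ^ 2) +
              x ⬝ᵥ x := by
          rw [← mulVec_mulVec, ← centredRowGram_transpose, ← mulVec_dotProduct_eq,
            centredRowGram_transpose, centredRowGram_mulVec]
          simp only [sub_dotProduct, dotProduct_sub, smul_dotProduct, dotProduct_smul, smul_eq_mul,
            dotProduct_comm x (U i)]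
          ring
        rw [e]
        obtain hi | hi := (hp₀ i).eq_or_lt
        · rw [row_eq_zero_of_prob_eq_zero hp hi.symm, ← hi]
          simp
        · have h : (p i)⁻¹ * (U i ⬝ᵥ U i) ≤ L + 1 := by
            rw [inv_mul_le_iff₀ hi, mul_comm]
            exact hp i
          have h' := mul_le_mul_of_nonneg_right h (sq_nonneg (U i ⬝ᵥ x))
          have hpi : p i * (p i)⁻¹ = 1 := mul_inv_cancel₀ hi.ne'
          calc _ = (p i * (p i)⁻¹) * ((p i)⁻¹ * (U i ⬝ᵥ U i) * (U i ⬝ᵥ x) ^ 2) -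
                2 * (p i * (p i)⁻¹) * (U i ⬝ᵥ x) ^ 2 + p i * (x ⬝ᵥ x) := by ring
            _ ≤ _ := by rw [hpi]; linarith
    _ = _ := by
        rw [Finset.sum_add_distrib, ← Finset.mul_sum, ← Finset.sum_mul, hp₁,
          sum_sq_row_dotProduct hU]
        ring

open Classical in
/-- The total weight of the samples whose sampled Gram matrix has relative error more than `ε`. -/
theorem sum_weight_gram_error_le (hU : Uᵀ * U = 1) (hp₀ : ∀ i, 0 ≤ p i) (hp₁ : ∑ i, p i = 1)
    (hL : 1 ≤ L) (hp : ∀ i, U i ⬝ᵥ U i ≤ (L + 1) * p i) {ε : ℝ} (hε₀ : 0 < ε) (hε₁ : ε < 1)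
    (hr : r ≠ 0) :
    ∑ t : Fin r → Fin m, (if ∃ x, ε * (x ⬝ᵥ x) <
        |(rowSamplingMatrix p t *ᵥ (U *ᵥ x)) ⬝ᵥ (rowSamplingMatrix p t *ᵥ (U *ᵥ x)) - x ⬝ᵥ x|
      then ∏ j, p (t j) else 0) ≤ 2 * d * Real.exp (-(r * ε ^ 2 / (4 * L))) := by
  have hL0 : 0 < L := by linarith
  have hr' : (0 : ℝ) < r := by positivity
  -- The minimiser of `θ²L - θε`, with minimum `-ε²/(4L)`; it also meets the constraint `θL ≤ 1`.
  set θ := ε / (2 * L) with hθ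
  have hθ0 : 0 < θ := by positivity
  have hθL : θ * L ≤ 1 := by
    have : θ * L = ε / 2 := by rw [hθ]; field_simp
    linarith
  have hexp : r * (θ ^ 2 * L) - θ * (r * ε) = -(r * ε ^ 2 / (4 * L)) := by
    rw [hθ]; field_simp; ring
  have hb (i : Fin m) (x : Fin d → ℝ) :
      θ * |x ⬝ᵥ (centredRowGram p U i *ᵥ x)| ≤ x ⬝ᵥ x := by
    have hx := dotProduct_self_nonneg_real x
    calc _ ≤ θ * (L * (x ⬝ᵥ x)) := by
          gcongr
          exact abs_dotProduct_centredRowGram_le hp₀ hL hp i x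
      _ = θ * L * (x ⬝ᵥ x) := by ring
      _ ≤ x ⬝ᵥ x := mul_le_of_le_one_left hx hθL
  have hmean := sum_smul_centredRowGram hU hp₁ hp
  have hvar := dotProduct_sum_sq_centredRowGram_le hU hp₀ hp₁ hp
  have h1 := sum_weight_lt_le (s := r * ε) hp₀ hp₁ (centredRowGram_transpose p U) hmean hθ0 hb hvar r
  -- The lower tail; the union of both tails produces the factor `2`.
  have h2 := sum_weight_lt_le (s := r * ε) (X := fun i => -centredRowGram p U i) hp₀ hp₁
    (fun i => by rw [transpose_neg, centredRowGram_transpose]) (by simp [hmean]) hθ0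
    (fun i x => by rw [neg_mulVec, dotProduct_neg, abs_neg]; exact hb i x)
    (fun x => by simpa using hvar x) r
  rw [hexp, Fintype.card_fin] at h1 h2
  calc _ ≤ _ := ?_
    _ ≤ _ := add_le_add h1 h2
    _ = _ := by ring
  rw [← Finset.sum_add_distrib]
  refine Finset.sum_le_sum fun t _ => ?_
  have hw : 0 ≤ ∏ j, p (t j) := Finset.prod_nonneg fun j _ => hp₀ _
  by_cases h : ∃ x, ε * (x ⬝ᵥ x) <
      |(rowSamplingMatrix p t *ᵥ (U *ᵥ x)) ⬝ᵥ (rowSamplingMatrix p t *ᵥ (U *ᵥ x)) - x ⬝ᵥ x|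
  · rw [if_pos h]
    obtain ⟨x, hx⟩ := h
    rw [rowSamplingMatrix_mulVec_sq hp₀ hr, abs_mul, abs_of_pos (inv_pos.2 hr'),
      lt_inv_mul_iff₀ hr', ← mul_assoc] at hx
    rcases lt_abs.1 hx with h' | h'
    · rw [if_pos ⟨x, h'⟩]
      refine le_add_of_nonneg_right ?_
      split_ifs <;> simp [hw]
    · have h3 : r * ε * (x ⬝ᵥ x) < x ⬝ᵥ ((∑ j, -centredRowGram p U (t j)) *ᵥ x) := by
        rwa [Finset.sum_neg_distrib, neg_mulVec, dotProduct_neg]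
      rw [if_pos (c := ∃ x, r * ε * (x ⬝ᵥ x) < x ⬝ᵥ ((∑ j, -centredRowGram p U (t j)) *ᵥ x)) ⟨x, h3⟩]
      refine le_add_of_nonneg_left ?_
      split_ifs <;> simp [hw]
  · rw [if_neg h]
    refine add_nonneg ?_ ?_ <;> split_ifs <;> simp [hw]

/-- A sample whose Gram matrix has relative error at most `ε` satisfies the reconstruction bound. -/
theorem norm_sub_mul_topProjection_le_of_gram_error {A : Matrix (Fin m) (Fin d) ℝ}
    {σ : Fin d → ℝ} {V : Matrix (Fin d) (Fin d) ℝ} (hA : IsThinSVD A U σ V) {ε : ℝ}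
    (hε₀ : 0 < ε) (hε₁ : ε < 1) {Q : Matrix (Fin r) (Fin m) ℝ}
    (hQ : ∀ x, |(Q *ᵥ (U *ᵥ x)) ⬝ᵥ (Q *ᵥ (U *ᵥ x)) - x ⬝ᵥ x| ≤ ε * (x ⬝ᵥ x))
    {U' : Matrix (Fin r) (Fin r) ℝ} {σ' : Fin d → ℝ} {V' : Matrix (Fin d) (Fin d) ℝ}
    (hB : IsFullSVD (Q * A) U' σ' V') {k : ℕ} (hk : k ≤ d) :
    ‖A - A * topProjection V' hk‖ ≤ √((1 + ε) / (1 - ε)) * ‖A - truncatedSVD U σ V hk‖ := by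
  have key (x : Fin d → ℝ) : |((Q * A) *ᵥ x) ⬝ᵥ ((Q * A) *ᵥ x) - (A *ᵥ x) ⬝ᵥ (A *ᵥ x)| ≤
      ε * ((A *ᵥ x) ⬝ᵥ (A *ᵥ x)) := by
    have h1 : A *ᵥ x = U *ᵥ ((diagonal σ * Vᵀ) *ᵥ x) := by
      rw [mulVec_mulVec, ← Matrix.mul_assoc, ← hA.eq]
    have h2 (y : Fin d → ℝ) : (U *ᵥ y) ⬝ᵥ (U *ᵥ y) = y ⬝ᵥ y := by
      rw [mulVec_dotProduct_eq, mulVec_mulVec, hA.orthonormal_left, one_mulVec]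
    rw [← mulVec_mulVec, h1, h2]
    exact hQ _
  refine norm_sub_mul_topProjection_le hε₀ hε₁ (fun x => ?_) (fun x => ?_) hB hk
  · linarith [(abs_le.1 (key x)).1]
  · linarith [(abs_le.1 (key x)).2]

open Classical in
/-- The probability of an event that depends on finitely many independent samples. -/
theorem measureReal_sample_eq_sum {Ω : Type*} [MeasurableSpace Ω] {P : Measure Ω}
    [IsProbabilityMeasure P] {t : Fin r → Ω → Fin m} (ht : ∀ j, Measurable (t j))
    (hindep : iIndepFun t P) (hlaw : ∀ j i, P.real {ω | t j ω = i} = p i)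
    (G : (Fin r → Fin m) → Prop) :
    P.real {ω | G fun j => t j ω} = ∑ τ, if G τ then ∏ j, p (τ j) else 0 := by
  have hT : Measurable fun ω j => t j ω := measurable_pi_lambda _ ht
  have hpt (τ : Fin r → Fin m) :
      P.real ((fun ω j => t j ω) ⁻¹' {τ}) = ∏ j, p (τ j) := by
    have h := hindep.measure_inter_preimage_eq_mul Finset.univ (sets := fun j => {τ j})
      fun _ _ => measurableSet_singleton _
    have e : (fun ω j => t j ω) ⁻¹' {τ} = ⋂ j ∈ Finset.univ, t j ⁻¹' {τ j} := by
      ext ω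
      simp [funext_iff]
    rw [e, measureReal_def, h, ENNReal.toReal_prod]
    exact Finset.prod_congr rfl fun j _ => hlaw j (τ j)
  rw [← Finset.sum_filter]
  simp only [← hpt]
  rw [sum_measureReal_preimage_singleton _ fun τ _ => hT (measurableSet_singleton τ)]
  congr 1
  ext ω
  simp

end RowSampling

/-! ### The main theorem: choice of constants and passage to the probability space -/

theorem mainTheorem5 {m d r : ℕ}
    (A U : Matrix (Fin m) (Fin d) ℝ) (σ : Fin d → ℝ) (V : Matrix (Fin d) (Fin d) ℝ)
    (hA : IsThinSVD A U σ V)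
    (ε β δ : ℝ) (hε₀ : 0 < ε) (hε₁ : ε < 1) (hβ₀ : 0 < β) (hβ₁ : β ≤ 1) (hδ : 0 < δ)
    (p : Fin m → ℝ) (hp₀ : ∀ i, 0 ≤ p i) (hp₁ : ∑ i, p i = 1)
    (hp : ∀ i, β / d * (U i ⬝ᵥ U i) ≤ p i)
    (hr : 4 * (d - β) / (β * ε ^ 2) * Real.log (2 * d / δ) ≤ r)
    {Ω : Type*} [MeasurableSpace Ω] (P : Measure Ω) [IsProbabilityMeasure P]
    (t : Fin r → Ω → Fin m) (ht : ∀ j, Measurable (t j)) (hindep : iIndepFun t P)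
    (hlaw : ∀ j i, P.real {ω | t j ω = i} = p i) :
    1 - δ ≤ P.real {ω |
      ∀ (U' : Matrix (Fin r) (Fin r) ℝ) (σ' : Fin d → ℝ) (V' : Matrix (Fin d) (Fin d) ℝ),
        IsFullSVD (rowSamplingMatrix p (fun j => t j ω) * A) U' σ' V' →
        ∀ (k : ℕ) (_ : 1 ≤ k) (hk : k ≤ d),
          ‖A - A * topProjection V' hk‖ ≤
            √((1 + ε) / (1 - ε)) * ‖A - truncatedSVD U σ V hk‖} := by
  classical
  obtain hδ1 | hδ1 := le_or_gt 1 δ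
  · exact (sub_nonpos.2 hδ1).trans measureReal_nonneg
  -- For `d ≤ 1` the bound `1 ≤ L` can fail, but then the only possible `k` is `d` and the left side
  -- is zero.
  obtain hd | hd := Nat.lt_or_ge d 2
  · convert (sub_le_self (1 : ℝ) hδ.le) using 1
    convert probReal_univ (μ := P) using 2
    refine Set.eq_univ_of_forall fun ω U' σ' V' h k hk1 hk => ?_
    obtain rfl : k = d := by omega
    rw [topProjection_self (mul_transpose_self_of_mem_orthogonalGroup h.orthogonal_right),
      Matrix.mul_one, sub_self, norm_zero]
    positivity
  have hd' : (2 : ℝ) ≤ d := by exact_mod_cast hd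
  set L : ℝ := (d - β) / β with hLdef
  have hL : 1 ≤ L := by
    rw [hLdef, le_div_iff₀ hβ₀]
    linarith
  have hL1 : L + 1 = d / β := by
    rw [hLdef]
    field_simp
    ring
  have hp' (i : Fin m) : U i ⬝ᵥ U i ≤ (L + 1) * p i := by
    have h := mul_le_mul_of_nonneg_left (hp i) (show 0 ≤ d / β by positivity)
    rwa [← mul_assoc, div_mul_div_cancel₀ hβ₀.ne', div_self (by positivity), one_mul, ← hL1] at h
  -- Positivity, from `δ < 1` and `d ≥ 2`, rules out `r = 0`.
  have hlog : 0 < Real.log (2 * d / δ) := by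
    apply Real.log_pos
    rw [lt_div_iff₀ hδ]
    linarith
  have hr4 : Real.log (2 * d / δ) ≤ r * ε ^ 2 / (4 * L) := by
    rw [le_div_iff₀ (by positivity)]
    have e : 4 * (d - β) / (β * ε ^ 2) * Real.log (2 * d / δ) =
        Real.log (2 * d / δ) * (4 * L) / ε ^ 2 := by
      rw [hLdef]
      field_simp
    rwa [e, div_le_iff₀ (by positivity)] at hr
  have hr0 : r ≠ 0 := by
    rintro rfl
    simp only [Nat.cast_zero, zero_mul, zero_div] at hr4
    linarith
  have htail := sum_weight_gram_error_le (r := r) hA.orthonormal_left hp₀ hp₁ hL hp' hε₀ hε₁ hr0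
  have hbound : 2 * d * Real.exp (-(r * ε ^ 2 / (4 * L))) ≤ δ := by
    calc 2 * d * Real.exp (-(r * ε ^ 2 / (4 * L)))
        ≤ 2 * d * Real.exp (-Real.log (2 * d / δ)) := by gcongr
      _ = δ := by
          rw [Real.exp_neg, Real.exp_log (by positivity)]
          field_simp
  rw [← measureReal_sample_eq_sum ht hindep hlaw fun τ => ∃ x, ε * (x ⬝ᵥ x) <
    |(rowSamplingMatrix p τ *ᵥ (U *ᵥ x)) ⬝ᵥ (rowSamplingMatrix p τ *ᵥ (U *ᵥ x)) - x ⬝ᵥ x|] at htail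
  rw [tsub_le_iff_right]
  refine le_trans ?_ (add_le_add_right (htail.trans hbound) _)
  refine (probReal_univ (μ := P)).ge.trans ?_
  -- The good and bad events cover `Ω`, so subadditivity suffices and measurability of the good
  -- event is not needed.
  refine (measureReal_mono fun ω _ => ?_).trans (measureReal_union_le _ _)
  rw [Set.mem_union, or_iff_not_imp_right]
  intro hω U' σ' V' hB k _ hk
  simp only [Set.mem_ofPred_eq, not_exists, not_lt] at hω
  exact norm_sub_mul_topProjection_le_of_gram_error hA hε₀ hε₁ hω hB hk
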